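/- For unital C*-algebras $X, Y$ let $X\otimes Y$ denote their spatial (minimal) tensor product, let $I_X$ denote the identity map of $X$, and identify $(X\otimes Y)\otimes Z$ with $X\otimes(Y\otimes Z)$ through $(x\otimes y)\otimes z\mapsto x\otimes(y\otimes z)$. A compact quantum semigroup is a pair $(A,\Delta)$ of a unital C*-algebra $A$ and a unital $*$-homomorphism $\Delta: A\to A\otimes A$ with $(\Delta\otimes I_A)\Delta=(I_A\otimes\Delta)\Delta$. For unital C*-algebras $A, B$, a quantum family of all maps from $\mathfrak{Q}B$ to $\mathfrak{Q}A$ (the quantum spaces dual to $B$ and $A$) is a pair $(C,\Phi)$ of a unital C*-algebra $C$ and a unital $*$-homomorphism $\Phi: A\to B\otimes C$ such that for every unital C*-algebra $D$ and every unital $*$-homomorphism $\Psi: A\to B\otimes D$ there is a unique unital $*$-homomorphism $\Lambda: C\to D$ with $(I_B\otimes\Lambda)\Phi=\Psi$. **Theorem.** Let $(A,\Delta)$ be a compact quantum semigroup such that $A$ is finitely generated (some finite subset of $A$ generates a dense unital $*$-subalgebra), let $B$ be a finite-dimensional commutative C*-algebra, and let $(C,\Phi)$ be the quantum family of all maps from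 $\mathfrak{Q}B$ to $\mathfrak{Q}A$. Let $F: C\otimes B\to B\otimes C$ be the flip, $F(c\otimes b)=b\otimes c$, and $m: B\otimes B\to B$ the multiplication $*$-homomorphism, $m(b\otimes b')=bb'$. Then there is a unique unital $*$-homomorphism $\Gamma: C\to C\otimes C$ with $$(I_B\otimes\Gamma)\,\Phi=(m\otimes I_{C\otimes C})\,(I_B\otimes F\otimes I_C)\,(\Phi\otimes\Phi)\,\Delta,$$ and this $\Gamma$ is coassociative, $(\Gamma\otimes I_C)\Gamma=(I_C\otimes\Gamma)\Gamma$; that is, $(C,\Gamma)$ is a compact quantum semigroup. -/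

import Mathlib

universe u

set_option linter.unusedSectionVars false

section

open scoped TensorProduct
open UniformSpace

namespace Spatial

noncomputable section

/-- A (unital) representation of a unital C⋆-algebra on a Hilbert space. -/
structure HilbertRep (A : Type u) [CStarAlgebra A] where
  /-- the Hilbert space -/
  space : Type u
  [normed : NormedAddCommGroup space]
  [innerProd : InnerProductSpace ℂ space]
  [complete : CompleteSpace space]
  /-- the action by bounded operators -/
  hom : A →⋆ₐ[ℂ] (space →L[ℂ] space)

attribute [instance] HilbertRep.normed HilbertRep.innerProd HilbertRep.complete

section Hilbert

variable (H K : Type u) [NormedAddCommGroup H] [InnerProductSpace ℂ H]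
  [NormedAddCommGroup K] [InnerProductSpace ℂ K]

/-- The Hilbert space tensor product: the completion of the algebraic tensor product. -/
def HilbertTensor : Type u := Completion (H ⊗[ℂ] K)

instance : NormedAddCommGroup (HilbertTensor H K) :=
  inferInstanceAs (NormedAddCommGroup (Completion (H ⊗[ℂ] K)))
instance : InnerProductSpace ℂ (HilbertTensor H K) :=
  inferInstanceAs (InnerProductSpace ℂ (Completion (H ⊗[ℂ] K)))
instance : CompleteSpace (HilbertTensor H K) :=
  inferInstanceAs (CompleteSpace (Completion (H ⊗[ℂ] K)))

variable {H K}

/-- The canonical map from the algebraic to the Hilbert space tensor product. -/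
def inc : H ⊗[ℂ] K →ₗᵢ[ℂ] HilbertTensor H K := Completion.toComplₗᵢ

theorem denseRange_inc : DenseRange (inc : H ⊗[ℂ] K → HilbertTensor H K) :=
  Completion.denseRange_coe

theorem op_ext {E : Type*} [NormedAddCommGroup E] [NormedSpace ℂ E]
    {S T : HilbertTensor H K →L[ℂ] E}
    (h : ∀ x y, S (inc (x ⊗ₜ[ℂ] y)) = T (inc (x ⊗ₜ[ℂ] y))) : S = T := by
  ext z
  induction z using denseRange_inc.induction_on with
  | hp => exact isClosed_eq S.continuous T.continuous
  | ih z =>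
    induction z using TensorProduct.induction_on with
    | zero => simp
    | tmul x y => exact h x y
    | add x y hx hy => simp [hx, hy]

theorem inner_ext {S T : HilbertTensor H K →L[ℂ] HilbertTensor H K}
    (h : ∀ x y x' y', inner ℂ (inc (x' ⊗ₜ[ℂ] y')) (S (inc (x ⊗ₜ[ℂ] y)))
      = inner ℂ (inc (x' ⊗ₜ[ℂ] y')) (T (inc (x ⊗ₜ[ℂ] y)))) : S = T := by
  refine op_ext fun x y => ?_
  refine ext_inner_left ℂ fun z => ?_
  have : (innerSL ℂ (S (inc (x ⊗ₜ[ℂ] y)))) = innerSL ℂ (T (inc (x ⊗ₜ[ℂ] y))) := by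
    refine op_ext fun x' y' => ?_
    have := congrArg star (h x y x' y')
    simpa using this
  have := congrArg star (DFunLike.congr_fun this z)
  simpa using this

/-- The extension of a bounded operator to the Hilbert space tensor product. -/
def extendOp (T : H ⊗[ℂ] K →L[ℂ] H ⊗[ℂ] K) : HilbertTensor H K →L[ℂ] HilbertTensor H K :=
  T.completion

@[simp] theorem extendOp_inc (T : H ⊗[ℂ] K →L[ℂ] H ⊗[ℂ] K) (x : H ⊗[ℂ] K) :
    extendOp T (inc x) = inc (T x) := T.completion_apply_coe x

variable [CompleteSpace H] [CompleteSpace K]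

variable (H K) in
/-- `T ↦ T ⊗ 1` on the Hilbert space tensor product. -/
def ampLeft : (H →L[ℂ] H) →⋆ₐ[ℂ] (HilbertTensor H K →L[ℂ] HilbertTensor H K) where
  toFun T := extendOp (T.rTensor K)
  map_one' := by refine op_ext fun x y => by simp
  map_mul' S T := by refine op_ext fun x y => by simp
  map_zero' := by refine op_ext fun x y => by simp
  map_add' S T := by refine op_ext fun x y => by simp
  commutes' r := by
    refine op_ext fun x y => by
      simp [Algebra.algebraMap_eq_smul_one]
  map_star' T := by
    refine inner_ext fun x y x' y' => ?_
    simp [ContinuousLinearMap.star_eq_adjoint, ContinuousLinearMap.adjoint_inner_right]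

variable (H K) in
/-- `T ↦ 1 ⊗ T` on the Hilbert space tensor product. -/
def ampRight : (K →L[ℂ] K) →⋆ₐ[ℂ] (HilbertTensor H K →L[ℂ] HilbertTensor H K) where
  toFun T := extendOp (T.lTensor H)
  map_one' := by refine op_ext fun x y => by simp
  map_mul' S T := by refine op_ext fun x y => by simp
  map_zero' := by refine op_ext fun x y => by simp
  map_add' S T := by refine op_ext fun x y => by simp
  commutes' r := by
    refine op_ext fun x y => by simp [Algebra.algebraMap_eq_smul_one]
  map_star' T := by
    refine inner_ext fun x y x' y' => ?_
    simp [ContinuousLinearMap.star_eq_adjoint, ContinuousLinearMap.adjoint_inner_right]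

theorem ampLeft_apply (T : H →L[ℂ] H) (z : H ⊗[ℂ] K) :
    ampLeft H K T (inc z) = inc (T.rTensor K z) :=
  extendOp_inc _ _

theorem ampRight_apply (T : K →L[ℂ] K) (z : H ⊗[ℂ] K) :
    ampRight H K T (inc z) = inc (T.lTensor H z) :=
  extendOp_inc _ _

theorem amp_commute (S : H →L[ℂ] H) (T : K →L[ℂ] K) :
    Commute (ampLeft H K S) (ampRight H K T) :=
  op_ext fun x y => by simp [ampLeft_apply, ampRight_apply]

end Hilbert

section Alg

variable {A B E : Type*} [CStarAlgebra A] [CStarAlgebra B] [CStarAlgebra E]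

/-- The ⋆-homomorphism `a ⊗ b ↦ f a * g b` on the algebraic tensor product,
for commuting `f`, `g`. -/
def algLift (f : A →⋆ₐ[ℂ] E) (g : B →⋆ₐ[ℂ] E) (h : ∀ a b, Commute (f a) (g b)) :
    A ⊗[ℂ] B →⋆ₐ[ℂ] E where
  __ := Algebra.TensorProduct.lift (f : A →ₐ[ℂ] E) (g : B →ₐ[ℂ] E) h
  map_star' x := by
    induction x using TensorProduct.induction_on with
    | zero => simp
    | tmul a b => simpa [map_star] using (h (star a) (star b)).eq
    | add x y hx hy => simp_all

@[simp] theorem algLift_tmul (f : A →⋆ₐ[ℂ] E) (g : B →⋆ₐ[ℂ] E) (h : ∀ a b, Commute (f a) (g b))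
    (a : A) (b : B) : algLift f g h (a ⊗ₜ[ℂ] b) = f a * g b := rfl

end Alg

variable {A B C D E : Type u} [CStarAlgebra A] [CStarAlgebra B] [CStarAlgebra C] [CStarAlgebra D]
  [CStarAlgebra E]

/-- The representation `π ⊗ σ` of the algebraic tensor product on the Hilbert tensor product. -/
def tensorAction (π : HilbertRep A) (σ : HilbertRep B) :
    A ⊗[ℂ] B →⋆ₐ[ℂ] (HilbertTensor π.space σ.space →L[ℂ] HilbertTensor π.space σ.space) :=
  algLift (E := HilbertTensor π.space σ.space →L[ℂ] HilbertTensor π.space σ.space)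
    ((ampLeft π.space σ.space).comp π.hom) ((ampRight π.space σ.space).comp σ.hom)
    fun a b => amp_commute (π.hom a) (σ.hom b)

theorem tensorAction_tmul (π : HilbertRep A) (σ : HilbertRep B) (a : A) (b : B) :
    tensorAction π σ (a ⊗ₜ b) = ampLeft π.space σ.space (π.hom a) * ampRight _ _ (σ.hom b) := rfl

theorem tensorAction_tmul_tmul (π : HilbertRep A) (σ : HilbertRep B) (a : A) (b : B)
    (x : π.space) (y : σ.space) :
    tensorAction π σ (a ⊗ₜ b) (inc (x ⊗ₜ y)) = inc (π.hom a x ⊗ₜ σ.hom b y) := by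
  simp [tensorAction_tmul, ampLeft_apply, ampRight_apply]

/-- The spatial (minimal) norm on the algebraic tensor product:
the supremum of `‖(π ⊗ σ)(x)‖` over all representations `π` of `A` and `σ` of `B`. -/
def spatialNorm (x : A ⊗[ℂ] B) : ℝ :=
  ⨆ p : HilbertRep A × HilbertRep B, ‖tensorAction p.1 p.2 x‖

theorem spatialNorm_bddAbove (x : A ⊗[ℂ] B) :
    BddAbove (Set.range fun p : HilbertRep A × HilbertRep B => ‖tensorAction p.1 p.2 x‖) := by
  suffices h : ∃ M : ℝ, ∀ p : HilbertRep A × HilbertRep B, ‖tensorAction p.1 p.2 x‖ ≤ M by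
    obtain ⟨M, hM⟩ := h
    exact ⟨M, Set.forall_mem_range.2 hM⟩
  induction x using TensorProduct.induction_on with
  | zero => exact ⟨0, fun p => by rw [map_zero, norm_zero]⟩
  | tmul a b =>
    refine ⟨‖a‖ * ‖b‖, fun p => ?_⟩
    refine (norm_mul_le (ampLeft _ _ (p.1.hom a)) (ampRight _ _ (p.2.hom b))).trans ?_
    gcongr
    · exact NonUnitalStarAlgHom.norm_apply_le ((ampLeft p.1.space p.2.space).comp p.1.hom) a
    · exact NonUnitalStarAlgHom.norm_apply_le ((ampRight p.1.space p.2.space).comp p.2.hom) b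
  | add x y hx hy =>
    obtain ⟨M, hM⟩ := hx
    obtain ⟨N, hN⟩ := hy
    refine ⟨M + N, fun p => ?_⟩
    rw [map_add]
    exact (norm_add_le _ _).trans (add_le_add (hM p) (hN p))

theorem le_spatialNorm (π : HilbertRep A) (σ : HilbertRep B) (x : A ⊗[ℂ] B) :
    ‖tensorAction π σ x‖ ≤ spatialNorm x :=
  le_ciSup (spatialNorm_bddAbove x) (π, σ)

instance : Nonempty (HilbertRep A) := ⟨{
  space := PUnit
  hom :=
   { toFun := fun _ => 0
     map_one' := Subsingleton.elim _ _
     map_mul' := fun _ _ => Subsingleton.elim _ _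
     map_zero' := Subsingleton.elim _ _
     map_add' := fun _ _ => Subsingleton.elim _ _
     commutes' := fun _ => Subsingleton.elim _ _
     map_star' := fun _ => Subsingleton.elim _ _ } }⟩

theorem spatialNorm_le {x : A ⊗[ℂ] B} {M : ℝ}
    (h : ∀ (π : HilbertRep A) (σ : HilbertRep B), ‖tensorAction π σ x‖ ≤ M) :
    spatialNorm x ≤ M :=
  ciSup_le fun p => h p.1 p.2

theorem spatialNorm_nonneg (x : A ⊗[ℂ] B) : 0 ≤ spatialNorm x :=
  Real.iSup_nonneg fun _ => norm_nonneg _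

theorem spatialNorm_smul (c : ℂ) (x : A ⊗[ℂ] B) :
    spatialNorm (c • x) = ‖c‖ * spatialNorm x := by
  rw [spatialNorm, spatialNorm, Real.mul_iSup_of_nonneg (norm_nonneg c)]
  congr with p
  rw [map_smul, norm_smul]

theorem spatialNorm_add_le (x y : A ⊗[ℂ] B) :
    spatialNorm (x + y) ≤ spatialNorm x + spatialNorm y := spatialNorm_le fun π σ => by
  rw [map_add]
  exact (norm_add_le _ _).trans (add_le_add (le_spatialNorm π σ x) (le_spatialNorm π σ y))

theorem spatialNorm_mul_le (x y : A ⊗[ℂ] B) :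
    spatialNorm (x * y) ≤ spatialNorm x * spatialNorm y := spatialNorm_le fun π σ => by
  rw [map_mul]
  exact (norm_mul_le _ _).trans (mul_le_mul (le_spatialNorm π σ x) (le_spatialNorm π σ y)
    (norm_nonneg _) (spatialNorm_nonneg _))

theorem spatialNorm_star (x : A ⊗[ℂ] B) : spatialNorm (star x) = spatialNorm x := by
  rw [spatialNorm, spatialNorm]
  congr with p
  rw [map_star, norm_star]

theorem spatialNorm_star_mul_self (x : A ⊗[ℂ] B) :
    spatialNorm x * spatialNorm x ≤ spatialNorm (star x * x) := by
  have h : spatialNorm x ≤ √(spatialNorm (star x * x)) := spatialNorm_le fun π σ => by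
    refine Real.le_sqrt_of_sq_le ?_
    rw [sq, ← CStarRing.norm_star_mul_self, ← map_star, ← map_mul]
    exact le_spatialNorm π σ _
  calc spatialNorm x * spatialNorm x
      ≤ √(spatialNorm (star x * x)) * √(spatialNorm (star x * x)) :=
        mul_self_le_mul_self (spatialNorm_nonneg x) h
    _ = spatialNorm (star x * x) := Real.mul_self_sqrt (spatialNorm_nonneg _)

variable (A B) in
/-- The algebraic tensor product, equipped with the spatial norm. -/
def AlgTensor : Type u := A ⊗[ℂ] B

instance : Ring (AlgTensor A B) := inferInstanceAs (Ring (A ⊗[ℂ] B))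
instance : Algebra ℂ (AlgTensor A B) := inferInstanceAs (Algebra ℂ (A ⊗[ℂ] B))
instance : StarRing (AlgTensor A B) := inferInstanceAs (StarRing (A ⊗[ℂ] B))
instance : StarModule ℂ (AlgTensor A B) := inferInstanceAs (StarModule ℂ (A ⊗[ℂ] B))
instance : Norm (AlgTensor A B) := ⟨spatialNorm (A := A) (B := B)⟩

instance : SeminormedRing (AlgTensor A B) where
  __ := (inferInstance : Ring (AlgTensor A B))
  __ := SeminormedAddCommGroup.ofCore (𝕜 := ℂ) (E := AlgTensor A B)
    { norm_nonneg := spatialNorm_nonneg (A := A) (B := B)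
      norm_smul := spatialNorm_smul (A := A) (B := B)
      norm_triangle := spatialNorm_add_le (A := A) (B := B) }
  norm_mul_le := spatialNorm_mul_le (A := A) (B := B)

instance : NormedAlgebra ℂ (AlgTensor A B) where
  norm_smul_le c x := (spatialNorm_smul (A := A) (B := B) c x).le

theorem uniformContinuous_star : UniformContinuous (star : AlgTensor A B → AlgTensor A B) :=
  (AddMonoidHomClass.isometry_of_norm (starAddEquiv : AlgTensor A B ≃+ AlgTensor A B)
    (spatialNorm_star (A := A) (B := B))).uniformContinuous

end

end Spatial

noncomputable section

open Spatial

section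

variable (A B : Type u) [CStarAlgebra A] [CStarAlgebra B]

/-- The spatial (minimal) C⋆-tensor product of two unital C⋆-algebras: the completion of the
algebraic tensor product in the spatial norm. -/
def SpatialTensor : Type u := Completion (AlgTensor A B)

namespace SpatialTensor

instance : NormedRing (SpatialTensor A B) :=
  inferInstanceAs (NormedRing (Completion (AlgTensor A B)))
instance : CompleteSpace (SpatialTensor A B) :=
  inferInstanceAs (CompleteSpace (Completion (AlgTensor A B)))
instance : Algebra ℂ (SpatialTensor A B) :=
  inferInstanceAs (Algebra ℂ (Completion (AlgTensor A B)))

variable {A B}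

/-- The canonical map from the algebraic tensor product, as a plain function. -/
def mk (x : A ⊗[ℂ] B) : SpatialTensor A B :=
  Completion.coe' (α := AlgTensor A B) x

theorem mk_add (x y : A ⊗[ℂ] B) : mk (x + y) = mk x + mk y :=
  Completion.coe_add (α := AlgTensor A B) x y
theorem mk_mul (x y : A ⊗[ℂ] B) : mk (x * y) = mk x * mk y :=
  Completion.coe_mul (α := AlgTensor A B) x y
theorem mk_algebraMap (c : ℂ) : mk (algebraMap ℂ (A ⊗[ℂ] B) c) = algebraMap ℂ _ c := rfl
theorem mk_smul (c : ℂ) (x : A ⊗[ℂ] B) : mk (c • x) = c • mk x := by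
  rw [Algebra.smul_def, Algebra.smul_def, mk_mul, mk_algebraMap]
theorem norm_mk (x : A ⊗[ℂ] B) : ‖mk x‖ = spatialNorm x := Completion.norm_coe (E := AlgTensor A B) x
theorem denseRange_mk : DenseRange (mk : A ⊗[ℂ] B → SpatialTensor A B) :=
  Completion.denseRange_coe (α := AlgTensor A B)

instance : NormedAlgebra ℂ (SpatialTensor A B) where
  norm_smul_le c x := norm_smul_le (α := ℂ) (β := Completion (AlgTensor A B)) c x

instance : Star (SpatialTensor A B) := ⟨Completion.map (star : AlgTensor A B → AlgTensor A B)⟩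

theorem mk_star (x : A ⊗[ℂ] B) : mk (star x) = star (mk x) :=
  (Completion.map_coe (uniformContinuous_star (A := A) (B := B)) x).symm

theorem continuous_star' : Continuous (star : SpatialTensor A B → SpatialTensor A B) :=
  Completion.continuous_map

instance : StarRing (SpatialTensor A B) where
  star_involutive x := by
    induction x using denseRange_mk.induction_on with
    | hp => exact isClosed_eq (continuous_star'.comp continuous_star') continuous_id
    | ih x => rw [← mk_star, ← mk_star, star_star]
  star_mul x y := by
    induction x, y using denseRange_mk.induction_on₂ with
    | hp =>
      exact isClosed_eq (continuous_star'.comp continuous_mul)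
       ((continuous_star'.comp continuous_snd).mul (continuous_star'.comp continuous_fst))
    | h x y => simp only [← mk_star, ← mk_mul, star_mul]
  star_add x y := by
    induction x, y using denseRange_mk.induction_on₂ with
    | hp =>
      exact isClosed_eq (continuous_star'.comp continuous_add)
       ((continuous_star'.comp continuous_fst).add (continuous_star'.comp continuous_snd))
    | h x y => simp only [← mk_star, ← mk_add, star_add]

instance : CStarAlgebra (SpatialTensor A B) where
  norm_mul_self_le x := by
    induction x using denseRange_mk.induction_on with
    | hp =>
      exact isClosed_le (f := fun x : SpatialTensor A B => ‖x‖ * ‖x‖)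
        (g := fun x : SpatialTensor A B => ‖star x * x‖) (continuous_norm.mul continuous_norm)
        (continuous_norm.comp (continuous_star'.mul continuous_id))
    | ih x =>
      rw [← mk_star, ← mk_mul, norm_mk, norm_mk]
      exact spatialNorm_star_mul_self x
  star_smul c x := by
    induction x using denseRange_mk.induction_on with
    | hp =>
      exact isClosed_eq (f := fun x : SpatialTensor A B => star (c • x))
        (g := fun x : SpatialTensor A B => star c • star x)
        (continuous_star'.comp (continuous_const_smul c))
        ((continuous_const_smul (star c)).comp continuous_star')
    | ih x => rw [← mk_smul, ← mk_star, ← mk_star, ← mk_smul, star_smul]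

variable (A B) in
/-- The canonical ⋆-homomorphism from the algebraic tensor product. -/
def of : A ⊗[ℂ] B →⋆ₐ[ℂ] SpatialTensor A B where
  toFun := mk
  map_one' := rfl
  map_zero' := rfl
  map_add' := mk_add
  map_mul' := mk_mul
  commutes' _ := rfl
  map_star' := mk_star

theorem norm_of (x : A ⊗[ℂ] B) : ‖of A B x‖ = spatialNorm x := norm_mk x
theorem denseRange_of : DenseRange (of A B) := denseRange_mk

/-- The elementary tensor `a ⊗ b`. -/
def tmul (a : A) (b : B) : SpatialTensor A B := of A B (a ⊗ₜ b)

theorem of_tmul (a : A) (b : B) : of A B (a ⊗ₜ b) = tmul a b := rfl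

end SpatialTensor

end

namespace SpatialTensor

section Hom

variable {F G : Type*} [CStarAlgebra F] [CStarAlgebra G]

theorem continuous_hom (f : F →⋆ₐ[ℂ] G) : Continuous f :=
  AddMonoidHomClass.continuous_of_bound f 1 fun x => by
    simpa using NonUnitalStarAlgHom.norm_apply_le f x

end Hom

variable {A B C D : Type u} [CStarAlgebra A] [CStarAlgebra B] [CStarAlgebra C] [CStarAlgebra D]

section
variable {E : Type*} [CStarAlgebra E]

@[elab_as_elim]
theorem induction_on {p : SpatialTensor A B → Prop} (x : SpatialTensor A B)
    (hp : IsClosed {x | p x}) (h : ∀ a b, p (tmul a b)) (add : ∀ x y, p x → p y → p (x + y)) :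
    p x := by
  have zero : p 0 := by simpa [tmul] using h 0 0
  induction x using denseRange_of.induction_on with
  | hp => exact hp
  | ih x =>
    induction x using TensorProduct.induction_on with
    | zero => simpa using zero
    | tmul a b => exact h a b
    | add x y hx hy => simpa using add _ _ hx hy

theorem hom_ext {f g : SpatialTensor A B →⋆ₐ[ℂ] E} (h : ∀ a b, f (tmul a b) = g (tmul a b)) :
    f = g := by
  ext x
  induction x using induction_on with
  | hp => exact isClosed_eq (continuous_hom f) (continuous_hom g)
  | h a b => exact h a b
  | add x y hx hy => simp [hx, hy]

/-- A ⋆-homomorphism on the algebraic tensor product which is contractive for the spatial norm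
extends to the spatial tensor product. -/
def extend (φ : A ⊗[ℂ] B →⋆ₐ[ℂ] E) (h : ∀ x, ‖φ x‖ ≤ spatialNorm x) :
    SpatialTensor A B →⋆ₐ[ℂ] E :=
  have hc : Continuous (RingHomClass.toRingHom φ : AlgTensor A B →+* E) :=
    AddMonoidHomClass.continuous_of_bound (RingHomClass.toRingHom φ : AlgTensor A B →+* E) 1
      fun x => by rw [one_mul]; exact h x
  have key : ∀ x : A ⊗[ℂ] B, Completion.extensionHom
      (RingHomClass.toRingHom φ : AlgTensor A B →+* E) hc (of A B x) = φ x := fun x =>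
    Completion.extensionHom_coe (RingHomClass.toRingHom φ : AlgTensor A B →+* E) hc x
  have hc' : Continuous (Completion.extensionHom
      (RingHomClass.toRingHom φ : AlgTensor A B →+* E) hc : SpatialTensor A B → E) :=
    Completion.continuous_extension
  { toFun := (Completion.extensionHom (RingHomClass.toRingHom φ : AlgTensor A B →+* E) hc :
      SpatialTensor A B → E)
    map_one' := map_one (Completion.extensionHom (RingHomClass.toRingHom φ : AlgTensor A B →+* E) hc)
    map_mul' := map_mul (Completion.extensionHom (RingHomClass.toRingHom φ : AlgTensor A B →+* E) hc)
    map_zero' := map_zero (Completion.extensionHom (RingHomClass.toRingHom φ : AlgTensor A B →+* E) hc)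
    map_add' := map_add (Completion.extensionHom (RingHomClass.toRingHom φ : AlgTensor A B →+* E) hc)
    commutes' := fun c => by
      have := key (algebraMap ℂ _ c)
      rw [AlgHomClass.commutes] at this
      rw [← AlgHomClass.commutes φ c, ← key]
      rw [AlgHomClass.commutes]
    map_star' := fun x => by
      induction x using denseRange_of.induction_on with
      | hp => exact isClosed_eq (hc'.comp continuous_star) (continuous_star.comp hc')
      | ih x => rw [← map_star, key, key, map_star] }

@[simp] theorem extend_of (φ : A ⊗[ℂ] B →⋆ₐ[ℂ] E) (h : ∀ x, ‖φ x‖ ≤ spatialNorm x)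
    (x : A ⊗[ℂ] B) : extend φ h (of A B x) = φ x :=
  Completion.extensionHom_coe (RingHomClass.toRingHom φ : AlgTensor A B →+* E)
    (AddMonoidHomClass.continuous_of_bound (RingHomClass.toRingHom φ : AlgTensor A B →+* E) 1
      fun x => by rw [one_mul]; exact h x) x

@[simp] theorem extend_tmul (φ : A ⊗[ℂ] B →⋆ₐ[ℂ] E) (h : ∀ x, ‖φ x‖ ≤ spatialNorm x)
    (a : A) (b : B) : extend φ h (tmul a b) = φ (a ⊗ₜ b) :=
  extend_of φ h _

end

/-- The extension of `π ⊗ σ` to the spatial tensor product. -/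
def tensorHom (π : HilbertRep A) (σ : HilbertRep B) : SpatialTensor A B →⋆ₐ[ℂ]
    (HilbertTensor π.space σ.space →L[ℂ] HilbertTensor π.space σ.space) :=
  extend (tensorAction π σ) (le_spatialNorm π σ)

theorem tensorHom_of (π : HilbertRep A) (σ : HilbertRep B) (x : A ⊗[ℂ] B) :
    tensorHom π σ (of A B x) = tensorAction π σ x := extend_of _ (le_spatialNorm π σ) _

theorem tensorHom_tmul (π : HilbertRep A) (σ : HilbertRep B) (a : A) (b : B)
    (h : π.space) (k : σ.space) :
    tensorHom π σ (tmul a b) (inc (h ⊗ₜ k)) = inc (π.hom a h ⊗ₜ σ.hom b k) := by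
  rw [← of_tmul, tensorHom_of, tensorAction_tmul_tmul]

/-- The representation `π ⊗ σ` of the spatial tensor product. -/
abbrev tensorRep (π : HilbertRep A) (σ : HilbertRep B) : HilbertRep (SpatialTensor A B) where
  space := HilbertTensor π.space σ.space
  hom := tensorHom π σ

/-- A norm estimate on the spatial tensor product may be checked on any set of pairs of
representations which determines the spatial norm. -/
theorem norm_le_of_forall_mem {S : Set (HilbertRep A × HilbertRep B)}
    (hS : ∀ (x : A ⊗[ℂ] B) (M : ℝ), (∀ p ∈ S, ‖tensorAction p.1 p.2 x‖ ≤ M) → spatialNorm x ≤ M)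
    {y : SpatialTensor A B} {M : ℝ}
    (h : ∀ p ∈ S, ‖tensorHom p.1 p.2 y‖ ≤ M) : ‖y‖ ≤ M := by
  refine le_of_forall_pos_le_add fun ε hε => ?_
  obtain ⟨x, hx⟩ := Metric.denseRange_iff.1 (denseRange_of (A := A) (B := B)) y (ε / 2) (half_pos hε)
  rw [dist_eq_norm] at hx
  have hx' : ‖of A B x‖ ≤ M + ε / 2 := by
    rw [norm_of]
    refine hS x _ fun p hp => ?_
    have h1 : tensorAction p.1 p.2 x
      = tensorHom p.1 p.2 y - tensorHom p.1 p.2 (y - of A B x) := by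
      rw [map_sub, tensorHom_of, sub_sub_cancel]
    rw [h1]
    refine (norm_sub_le _ _).trans (add_le_add (h p hp) ?_)
    exact (NonUnitalStarAlgHom.norm_apply_le (tensorHom p.1 p.2) _).trans hx.le
  calc ‖y‖ = ‖of A B x + (y - of A B x)‖ := by rw [add_sub_cancel]
    _ ≤ (M + ε / 2) + ε / 2 := (norm_add_le _ _).trans (add_le_add hx' hx.le)
    _ = M + ε := by ring

theorem norm_le_of_forall {y : SpatialTensor A B} {M : ℝ}
    (h : ∀ (π : HilbertRep A) (σ : HilbertRep B), ‖tensorHom π σ y‖ ≤ M) : ‖y‖ ≤ M :=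
  norm_le_of_forall_mem (S := Set.univ)
    (fun _ _ hx => spatialNorm_le fun π σ => hx (π, σ) trivial) fun p _ => h p.1 p.2

/-- Restriction of a representation along a ⋆-homomorphism. -/
def comapRep (π : HilbertRep B) (f : A →⋆ₐ[ℂ] B) : HilbertRep A where
  space := π.space
  hom := π.hom.comp f

/-- The algebraic tensor product of two ⋆-homomorphisms. -/
def algMap (f : A →⋆ₐ[ℂ] C) (g : B →⋆ₐ[ℂ] D) : A ⊗[ℂ] B →⋆ₐ[ℂ] C ⊗[ℂ] D where
  __ := Algebra.TensorProduct.map (f : A →ₐ[ℂ] C) (g : B →ₐ[ℂ] D)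
  map_star' x := by
    induction x using TensorProduct.induction_on with
    | zero => simp
    | tmul a b => simp [map_star]
    | add x y hx hy => simp_all

theorem algMap_tmul (f : A →⋆ₐ[ℂ] C) (g : B →⋆ₐ[ℂ] D) (a : A) (b : B) :
    algMap f g (a ⊗ₜ b) = f a ⊗ₜ g b := rfl

theorem spatialNorm_algMap_le (f : A →⋆ₐ[ℂ] C) (g : B →⋆ₐ[ℂ] D) (x : A ⊗[ℂ] B) :
    spatialNorm (algMap f g x) ≤ spatialNorm x := spatialNorm_le fun π σ => by
  have : tensorAction π σ (algMap f g x) = tensorAction (comapRep π f) (comapRep σ g) x := by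
    induction x using TensorProduct.induction_on with
    | zero => simp only [map_zero]; rfl
    | tmul a b => rfl
    | add x y hx hy => simp only [map_add, hx, hy]; rfl
  rw [this]
  exact le_spatialNorm (comapRep π f) (comapRep σ g) x

/-- The tensor product `f ⊗ g` of two ⋆-homomorphisms. -/
def map (f : A →⋆ₐ[ℂ] C) (g : B →⋆ₐ[ℂ] D) : SpatialTensor A B →⋆ₐ[ℂ] SpatialTensor C D :=
  extend ((of C D).comp (algMap f g)) fun x => by
    rw [StarAlgHom.comp_apply, norm_of]
    exact spatialNorm_algMap_le f g x

@[simp] theorem map_tmul (f : A →⋆ₐ[ℂ] C) (g : B →⋆ₐ[ℂ] D) (a : A) (b : B) :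
    map f g (tmul a b) = tmul (f a) (g b) := extend_tmul _ _ _ _

section Intertwine

variable {H H' : Type*} [NormedAddCommGroup H] [InnerProductSpace ℂ H]
  [NormedAddCommGroup H'] [InnerProductSpace ℂ H']

theorem norm_le_of_intertwine (U : H →ₗᵢ[ℂ] H') (hU : DenseRange U) {T : H →L[ℂ] H}
    {T' : H' →L[ℂ] H'} (h : ∀ x, T' (U x) = U (T x)) : ‖T'‖ ≤ ‖T‖ := by
  refine T'.opNorm_le_bound (norm_nonneg _) fun z => ?_
  induction z using hU.induction_on with
  | hp => exact isClosed_le (by fun_prop) (by fun_prop)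
  | ih x =>
    rw [h, U.norm_map, U.norm_map]
    exact T.le_opNorm x

theorem exists_extension {P : Type*} [NormedAddCommGroup P] [InnerProductSpace ℂ P]
    [CompleteSpace H'] (V : P →ₗᵢ[ℂ] H) (hV : DenseRange V) (V' : P →ₗᵢ[ℂ] H')
    (hV' : DenseRange V') : ∃ U : H →ₗᵢ[ℂ] H', DenseRange U ∧ ∀ x, U (V x) = V' x := by
  let U₀ : H →L[ℂ] H' := V'.toContinuousLinearMap.extend V.toContinuousLinearMap
  have hU₀ : ∀ x, U₀ (V x) = V' x := fun x =>
    ContinuousLinearMap.extend_eq _ hV V.isometry.isUniformInducing x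
  refine ⟨⟨U₀.toLinearMap, fun x => ?_⟩, ?_, hU₀⟩
  · induction x using hV.induction_on with
    | hp => exact isClosed_eq (U₀.continuous.norm) continuous_norm
    | ih x =>
      change ‖U₀ (V x)‖ = _
      rw [hU₀, V'.norm_map, V.norm_map]
  · refine hV'.mono ?_
    rintro _ ⟨x, rfl⟩
    exact ⟨V x, hU₀ x⟩

end Intertwine

/-- The flip on the algebraic tensor product. -/
def algComm : A ⊗[ℂ] B →⋆ₐ[ℂ] B ⊗[ℂ] A where
  __ := (Algebra.TensorProduct.comm ℂ A B : A ⊗[ℂ] B →ₐ[ℂ] B ⊗[ℂ] A)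
  map_star' x := by
    induction x using TensorProduct.induction_on with
    | zero => simp
    | tmul a b => simp
    | add x y hx hy => simp_all

theorem algComm_tmul (a : A) (b : B) : algComm (a ⊗ₜ[ℂ] b) = b ⊗ₜ a := rfl

theorem spatialNorm_algComm_le (x : A ⊗[ℂ] B) :
    spatialNorm (algComm x) ≤ spatialNorm x := spatialNorm_le fun π σ => by
  obtain ⟨U, hU, hU'⟩ := exists_extension (inc (H := σ.space) (K := π.space)) denseRange_inc
    ((inc (H := π.space) (K := σ.space)).comp
      (TensorProduct.commIsometry ℂ σ.space π.space).toLinearIsometry)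
    (denseRange_inc.comp (TensorProduct.commIsometry ℂ σ.space π.space).surjective.denseRange
      inc.continuous)
  refine (norm_le_of_intertwine U hU (T := tensorAction σ π x) ?_).trans (le_spatialNorm σ π x)
  have : (tensorAction π σ (algComm x)).comp U.toContinuousLinearMap
      = U.toContinuousLinearMap.comp (tensorAction σ π x) := by
    induction x using TensorProduct.induction_on with
    | zero => ext; simp
    | tmul a b =>
      refine op_ext fun h k => ?_
      simp [hU', algComm_tmul, tensorAction_tmul_tmul]
    | add x y hx hy => rw [map_add, map_add, map_add, ContinuousLinearMap.add_comp, hx, hy, ContinuousLinearMap.comp_add]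
  exact fun z => DFunLike.congr_fun this z

variable (A B) in
/-- The flip `a ⊗ b ↦ b ⊗ a`. -/
def comm : SpatialTensor A B →⋆ₐ[ℂ] SpatialTensor B A :=
  extend ((of B A).comp algComm) fun x => by
    rw [StarAlgHom.comp_apply, norm_of]
    exact spatialNorm_algComm_le x

@[simp] theorem comm_tmul (a : A) (b : B) : comm A B (tmul a b) = tmul b a := extend_tmul _ _ _ _

end SpatialTensor

namespace SpatialTensor

section Matrix

variable {A D : Type u} [CStarAlgebra A] [CStarAlgebra D]
variable {ι : Type*} [Fintype ι]

attribute [local instance] CStarAlgebra.spectralOrder CStarAlgebra.spectralOrderedRing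

/-- The quadratic form on `ι → ρ.space` given by a matrix over `D` and a representation `ρ`. -/
def quadForm (ρ : HilbertRep D) (S : CStarMatrix ι ι D) (l : ι → ρ.space) : ℂ :=
  ∑ i, ∑ j, inner ℂ (l i) (ρ.hom (S i j) (l j))

/-- The action of matrices over `D` on `ι → ρ.space`. -/
def matAct (ρ : HilbertRep D) (R : CStarMatrix ι ι D) (l : ι → ρ.space) : ι → ρ.space :=
  fun i => ∑ j, ρ.hom (R i j) (l j)

theorem quadForm_eq (ρ : HilbertRep D) (S : CStarMatrix ι ι D) (l : ι → ρ.space) :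
    quadForm ρ S l = ∑ i, inner ℂ (l i) (matAct ρ S l i) := by
  simp [quadForm, matAct]

theorem matAct_mul (ρ : HilbertRep D) (S R : CStarMatrix ι ι D) (l : ι → ρ.space) :
    matAct ρ (S * R) l = matAct ρ S (matAct ρ R l) := by
  ext i
  simp only [matAct, CStarMatrix.mul_apply, map_sum, map_mul]
  simp only [sum_apply, mul_apply_eq_comp]
  rw [Finset.sum_comm]

theorem inner_matAct_star (ρ : HilbertRep D) (R : CStarMatrix ι ι D) (l l' : ι → ρ.space) :
    ∑ i, inner ℂ (l i) (matAct ρ (star R) l' i) = ∑ i, inner ℂ (matAct ρ R l i) (l' i) := by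
  simp only [matAct, inner_sum, sum_inner]
  rw [Finset.sum_comm]
  refine Finset.sum_congr rfl fun i _ => Finset.sum_congr rfl fun j _ => ?_
  rw [CStarMatrix.star_apply, map_star, ContinuousLinearMap.star_eq_adjoint,
    ContinuousLinearMap.adjoint_inner_right]

theorem quadForm_conj (ρ : HilbertRep D) (R S : CStarMatrix ι ι D) (l : ι → ρ.space) :
    quadForm ρ (star R * (S * R)) l = quadForm ρ S (matAct ρ R l) := by
  rw [quadForm_eq, matAct_mul, inner_matAct_star, matAct_mul, quadForm_eq]

theorem quadForm_star_mul_self (ρ : HilbertRep D) (R : CStarMatrix ι ι D) (l : ι → ρ.space) :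
    quadForm ρ (star R * R) l = ((∑ i, ‖matAct ρ R l i‖ ^ 2 : ℝ) : ℂ) := by
  rw [quadForm_eq, matAct_mul, inner_matAct_star]
  simp [inner_self_eq_norm_sq_to_K]

theorem quadForm_sub (ρ : HilbertRep D) (R S : CStarMatrix ι ι D) (l : ι → ρ.space) :
    quadForm ρ (R - S) l = quadForm ρ R l - quadForm ρ S l := by
  simp [quadForm]

theorem eq_zero_of_cube {X : Type*} [CStarAlgebra X] {N : X} (hN : IsSelfAdjoint N)
    (h : N * (N * N) = 0) : N = 0 := by
  have h2 : N * N = 0 := by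
    rw [← CStarRing.star_mul_self_eq_zero_iff, star_mul, hN.star_eq, mul_assoc, h, mul_zero]
  rwa [← CStarRing.star_mul_self_eq_zero_iff, hN.star_eq]

theorem exists_negPart {X : Type*} [CStarAlgebra X] {S : X} (hS : IsSelfAdjoint S) :
    ∃ N R : X, IsSelfAdjoint N ∧ S * N = -(N * N) ∧ N * (N * N) = star R * R ∧
      (R = 0 → ∃ R' : X, S = star R' * R') := by
  have hN0 : 0 ≤ S⁻ := CFC.negPart_nonneg S
  have hN : IsSelfAdjoint S⁻ := IsSelfAdjoint.of_nonneg hN0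
  have hdec : S⁺ - S⁻ = S := CFC.posPart_sub_negPart S hS
  have hSN : S * S⁻ = -(S⁻ * S⁻) := by
    have := congrArg (· * S⁻) hdec
    simp only [sub_mul, CFC.posPart_mul_negPart, zero_sub] at this
    exact this.symm
  have h3 : 0 ≤ star S⁻ * S⁻ * S⁻ := star_left_conjugate_nonneg hN0 S⁻
  obtain ⟨R, hR⟩ := CStarAlgebra.nonneg_iff_eq_star_mul_self.1 h3
  rw [hN.star_eq, mul_assoc] at hR
  refine ⟨S⁻, R, hN, hSN, hR, fun hR0 => ?_⟩
  have hNz : S⁻ = 0 := eq_zero_of_cube hN (by rw [hR, hR0, mul_zero])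
  have hS0 : 0 ≤ S := by
    rw [← hdec, hNz, sub_zero]
    exact CFC.posPart_nonneg S
  exact CStarAlgebra.nonneg_iff_eq_star_mul_self.1 hS0

/-- Positivity of a matrix over `D` may be tested on a jointly faithful family. -/
theorem quadForm_nonneg [DecidableEq ι] {P : HilbertRep D → Prop}
    (hP : ∀ d : D, (∀ ρ, P ρ → ρ.hom d = 0) → d = 0)
    {S : CStarMatrix ι ι D} (hS : IsSelfAdjoint S)
    (h : ∀ ρ, P ρ → ∀ l : ι → ρ.space, 0 ≤ (quadForm ρ S l).re)
    (ρ : HilbertRep D) (l : ι → ρ.space) : 0 ≤ (quadForm ρ S l).re := by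
  obtain ⟨N, R, hN, hSN, hR, hR'⟩ := exists_negPart hS
  have hR0 : R = 0 := by
    ext i j
    refine hP _ fun σ hσ => ?_
    ext v
    have h1 := h σ hσ (matAct σ N (Pi.single j v))
    have h2 : quadForm σ (-(star R * R)) (Pi.single j v)
        = - quadForm σ (star R * R) (Pi.single j v) := by
      rw [← zero_sub, quadForm_sub]
      simp [quadForm]
    rw [← quadForm_conj, hSN, hN.star_eq, mul_neg, hR, h2, quadForm_star_mul_self,
      Complex.neg_re, Complex.ofReal_re, Left.nonneg_neg_iff] at h1
    have h4 := (Finset.sum_eq_zero_iff_of_nonneg (fun i _ => sq_nonneg _)).1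
      (le_antisymm h1 (Finset.sum_nonneg fun i _ => sq_nonneg _)) i (Finset.mem_univ i)
    have h5 : matAct σ R (Pi.single j v) i = 0 := by simpa using h4
    rw [matAct, Finset.sum_eq_single j] at h5
    · simpa using h5
    · intro k _ hk
      rw [Pi.single_eq_of_ne hk, map_zero]
    · simp
  obtain ⟨R', hS'⟩ := hR' hR0
  rw [hS', quadForm_star_mul_self, Complex.ofReal_re]
  positivity

end Matrix

section Key

variable {A D : Type u} [CStarAlgebra A] [CStarAlgebra D]

theorem exists_orthonormal_sum {H K : Type u} [NormedAddCommGroup H] [InnerProductSpace ℂ H]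
    [NormedAddCommGroup K] [InnerProductSpace ℂ K] (ξ : H ⊗[ℂ] K) :
    ∃ (n : ℕ) (e : Fin n → H) (l : Fin n → K), Orthonormal ℂ e ∧ ξ = ∑ i, e i ⊗ₜ l i := by
  obtain ⟨E', F', iE', iF', hz⟩ :=
    TensorProduct.exists_finite_submodule_of_setFinite {ξ} (Set.finite_singleton ξ)
  obtain ⟨y, rfl⟩ := Set.singleton_subset_iff.mp hz
  let e := stdOrthonormalBasis ℂ E'
  refine ⟨Module.finrank ℂ E', fun i => (e i : H), ?_⟩
  suffices h : ∃ l : Fin (Module.finrank ℂ E') → F', y = ∑ i, e i ⊗ₜ l i by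
    obtain ⟨l, hl⟩ := h
    refine ⟨fun i => l i, e.orthonormal.comp_linearIsometry E'.subtypeₗᵢ, ?_⟩
    rw [hl, map_sum]
    rfl
  clear hz
  induction y using TensorProduct.induction_on with
  | zero => exact ⟨0, by simp⟩
  | tmul a b =>
    refine ⟨fun i => e.repr a i • b, ?_⟩
    conv_lhs => rw [← e.sum_repr a, TensorProduct.sum_tmul]
    exact Finset.sum_congr rfl fun i _ => TensorProduct.smul_tmul _ _ _
  | add x y hx hy =>
    obtain ⟨l, hl⟩ := hx
    obtain ⟨l', hl'⟩ := hy
    exact ⟨l + l', by simp [hl, hl', TensorProduct.tmul_add, Finset.sum_add_distrib]⟩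

theorem norm_sum_sq {H K : Type u} [NormedAddCommGroup H] [InnerProductSpace ℂ H]
    [NormedAddCommGroup K] [InnerProductSpace ℂ K] {ι : Type*} [Fintype ι]
    {e : ι → H} (he : Orthonormal ℂ e) (l : ι → K) :
    ‖∑ i, e i ⊗ₜ[ℂ] l i‖ ^ 2 = ∑ i, ‖l i‖ ^ 2 := by
  classical
  have h : inner ℂ (∑ i, e i ⊗ₜ[ℂ] l i) (∑ i, e i ⊗ₜ[ℂ] l i) = ∑ i, inner ℂ (l i) (l i) := by
    simp [sum_inner, inner_sum, orthonormal_iff_ite.1 he]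
  rw [← inner_self_eq_norm_sq (𝕜 := ℂ), h, map_sum]
  exact Finset.sum_congr rfl fun i _ => inner_self_eq_norm_sq _

/-- The matrix `(⟪π(x) e i, π(x) e j⟫)` over `D`, for `x = ∑ k, a k ⊗ d k`. -/
def gramMatrix {m : ℕ} {ι : Type*} (π : HilbertRep A) (a : Fin m → A) (d : Fin m → D)
    (e : ι → π.space) : CStarMatrix ι ι D :=
  CStarMatrix.ofMatrix <| Matrix.of fun i j =>
    ∑ k, ∑ k', (inner ℂ (π.hom (a k) (e i)) (π.hom (a k') (e j)) : ℂ) • (star (d k) * d k')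

theorem gramMatrix_apply {m : ℕ} {ι : Type*} (π : HilbertRep A) (a : Fin m → A) (d : Fin m → D)
    (e : ι → π.space) (i j : ι) : gramMatrix π a d e i j =
    ∑ k, ∑ k', (inner ℂ (π.hom (a k) (e i)) (π.hom (a k') (e j)) : ℂ) • (star (d k) * d k') := rfl

theorem gramMatrix_selfAdjoint {m : ℕ} {ι : Type*} (π : HilbertRep A) (a : Fin m → A)
    (d : Fin m → D) (e : ι → π.space) : IsSelfAdjoint (gramMatrix π a d e) := by
  ext i j
  rw [CStarMatrix.star_apply]
  simp only [gramMatrix_apply, star_sum, star_smul, star_mul, star_star]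
  rw [Finset.sum_comm]
  simp

theorem quadForm_gramMatrix {m : ℕ} {ι : Type*} [Fintype ι] (π : HilbertRep A) (a : Fin m → A)
    (d : Fin m → D) (e : ι → π.space) (ρ : HilbertRep D) (l : ι → ρ.space) :
    (quadForm ρ (gramMatrix π a d e) l).re
      = ‖tensorAction π ρ (∑ k, a k ⊗ₜ d k) (inc (∑ i, e i ⊗ₜ l i))‖ ^ 2 := by
  have h1 : tensorAction π ρ (∑ k, a k ⊗ₜ d k) (inc (∑ i, e i ⊗ₜ l i))
      = inc (∑ i, ∑ k, π.hom (a k) (e i) ⊗ₜ ρ.hom (d k) (l i)) := by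
    simp only [map_sum, sum_apply, tensorAction_tmul_tmul]
  rw [h1, inc.norm_map, ← inner_self_eq_norm_sq (𝕜 := ℂ)]
  change _ = Complex.re _
  congr 1
  simp only [quadForm, gramMatrix_apply, map_sum, sum_apply, inner_sum,
    sum_inner, TensorProduct.inner_tmul, map_smul, map_mul, map_star, smul_apply,
    mul_apply_eq_comp, inner_smul_right, ContinuousLinearMap.star_eq_adjoint,
    ContinuousLinearMap.adjoint_inner_right]
  rw [Finset.sum_comm]
  refine Finset.sum_congr rfl fun i _ => Eq.trans ?_ Finset.sum_comm
  exact Finset.sum_congr rfl fun j _ => Finset.sum_comm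

theorem quadForm_smul_one {ι : Type*} [Fintype ι] [DecidableEq ι] (ρ : HilbertRep D) (c : ℝ)
    (l : ι → ρ.space) :
    (quadForm ρ ((c : ℂ) • 1) l).re = c * ∑ i, ‖l i‖ ^ 2 := by
  have h : matAct ρ ((c : ℂ) • 1) l = (c : ℂ) • l := by
    ext i
    rw [matAct, Finset.sum_eq_single i]
    · rw [CStarMatrix.smul_apply, CStarMatrix.one_apply_eq, map_smul, map_one]
      rfl
    · intro j _ hj
      rw [CStarMatrix.smul_apply, CStarMatrix.one_apply_ne hj.symm]
      simp
    · simp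
  rw [quadForm_eq, h]
  simp [inner_self_eq_norm_sq_to_K, Finset.mul_sum, ← Complex.ofReal_pow]

/-- If the representations satisfying `P` are jointly faithful on `D`, they suffice to compute
the spatial norm. -/
theorem spatialNorm_le_of_faithful {P : HilbertRep D → Prop}
    (hP : ∀ d : D, (∀ ρ, P ρ → ρ.hom d = 0) → d = 0) {x : A ⊗[ℂ] D} {M : ℝ} (hM0 : 0 ≤ M)
    (hM : ∀ (π : HilbertRep A) (ρ : HilbertRep D), P ρ → ‖tensorAction π ρ x‖ ≤ M) :
    spatialNorm x ≤ M := spatialNorm_le fun π ρ => by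
  obtain ⟨m, a, d, rfl⟩ := TensorProduct.exists_sum_tmul_eq x
  refine (tensorAction π ρ _).opNorm_le_bound hM0 fun z => ?_
  induction z using denseRange_inc.induction_on with
  | hp => exact isClosed_le (by fun_prop) (by fun_prop)
  | ih ξ =>
    obtain ⟨n, e, l, he, rfl⟩ := exists_orthonormal_sum ξ
    set S : CStarMatrix (Fin n) (Fin n) D := ((M ^ 2 : ℝ) : ℂ) • 1 - gramMatrix π a d e with hSdef
    have hS : IsSelfAdjoint S := by
      refine IsSelfAdjoint.sub ?_ (gramMatrix_selfAdjoint π a d e)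
      refine IsSelfAdjoint.smul ?_ (.one _)
      exact Complex.conj_ofReal _
    have hq : ∀ (σ : HilbertRep D) (l : Fin n → σ.space), (quadForm σ S l).re
        = M ^ 2 * ‖inc (∑ i, e i ⊗ₜ[ℂ] l i)‖ ^ 2
          - ‖tensorAction π σ (∑ k, a k ⊗ₜ d k) (inc (∑ i, e i ⊗ₜ l i))‖ ^ 2 := by
      intro σ l
      rw [hSdef, quadForm_sub, Complex.sub_re, quadForm_gramMatrix, inc.norm_map, norm_sum_sq he]
      rw [quadForm_smul_one]
    have := quadForm_nonneg hP hS (fun σ hσ l => ?_) ρ l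
    · rw [hq, sub_nonneg, ← mul_pow] at this
      exact le_of_sq_le_sq this (by positivity)
    · rw [hq, sub_nonneg, ← mul_pow]
      gcongr
      exact ContinuousLinearMap.le_of_opNorm_le _ (hM π σ hσ) _

end Key

theorem norm_le_of_forall₃ {A B C : Type u} [CStarAlgebra A] [CStarAlgebra B] [CStarAlgebra C]
    {y : SpatialTensor A (SpatialTensor B C)} {M : ℝ}
    (h : ∀ (π : HilbertRep A) (σ : HilbertRep B) (τ : HilbertRep C),
      ‖tensorHom π (tensorRep σ τ) y‖ ≤ M) : ‖y‖ ≤ M := by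
  let P : HilbertRep (SpatialTensor B C) → Prop := fun ρ => ∃ σ τ, ρ = tensorRep σ τ
  have hP : ∀ d : SpatialTensor B C, (∀ ρ, P ρ → ρ.hom d = 0) → d = 0 := fun d hd => by
    refine norm_le_zero_iff.1 (norm_le_of_forall fun σ τ => ?_)
    have := hd _ ⟨σ, τ, rfl⟩
    exact (congrArg norm this).trans_le norm_zero.le
  refine norm_le_of_forall_mem (S := {p | P p.2}) (fun x N hx => ?_) ?_
  · obtain ⟨π⟩ := (inferInstance : Nonempty (HilbertRep A))
    obtain ⟨σ⟩ := (inferInstance : Nonempty (HilbertRep B))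
    obtain ⟨τ⟩ := (inferInstance : Nonempty (HilbertRep C))
    have hN : 0 ≤ N := (norm_nonneg _).trans (hx (π, tensorRep σ τ) ⟨σ, τ, rfl⟩)
    exact spatialNorm_le_of_faithful hP hN fun π ρ hρ => hx (π, ρ) hρ
  · rintro ⟨π, _⟩ ⟨σ, τ, rfl⟩
    exact h π σ τ

end SpatialTensor

namespace SpatialTensor

variable {A B C D : Type u} [CStarAlgebra A] [CStarAlgebra B] [CStarAlgebra C] [CStarAlgebra D]

theorem tmul_mul_tmul (a a' : A) (b b' : B) :
    tmul a b * tmul a' b' = tmul (a * a') (b * b') := by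
  rw [tmul, tmul, ← map_mul, Algebra.TensorProduct.tmul_mul_tmul, tmul]

variable (A B) in
/-- The embedding `a ↦ a ⊗ 1`. -/
def inl : A →⋆ₐ[ℂ] SpatialTensor A B where
  __ := ((of A B : A ⊗[ℂ] B →ₐ[ℂ] SpatialTensor A B)).comp Algebra.TensorProduct.includeLeft
  map_star' a := by
    change of A B (star a ⊗ₜ 1) = star (of A B (a ⊗ₜ 1))
    rw [← map_star, TensorProduct.star_tmul, star_one]

variable (A B) in
/-- The embedding `b ↦ 1 ⊗ b`. -/
def inr : B →⋆ₐ[ℂ] SpatialTensor A B where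
  __ := ((of A B : A ⊗[ℂ] B →ₐ[ℂ] SpatialTensor A B)).comp Algebra.TensorProduct.includeRight
  map_star' b := by
    change of A B (1 ⊗ₜ star b) = star (of A B (1 ⊗ₜ b))
    rw [← map_star, TensorProduct.star_tmul, star_one]

theorem inl_apply (a : A) : inl A B a = tmul a 1 := rfl
theorem inr_apply (b : B) : inr A B b = tmul 1 b := rfl

/-- The associator on the algebraic tensor product of `A ⊗ B` with `C`. -/
def preAssoc : SpatialTensor A B ⊗[ℂ] C →⋆ₐ[ℂ] SpatialTensor A (SpatialTensor B C) :=
  algLift (map (StarAlgHom.id ℂ A) (inl B C)) ((inr A (SpatialTensor B C)).comp (inr B C))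
    fun x c => by
      change map (StarAlgHom.id ℂ A) (inl B C) x * tmul 1 (tmul 1 c)
        = tmul 1 (tmul 1 c) * map (StarAlgHom.id ℂ A) (inl B C) x
      induction x using induction_on with
      | hp =>
        have := continuous_hom (map (StarAlgHom.id ℂ A) (inl B C))
        exact isClosed_eq (by fun_prop) (by fun_prop)
      | h a b => simp [inl_apply, tmul_mul_tmul]
      | add x y hx hy => rw [map_add, add_mul, mul_add, hx, hy]

theorem preAssoc_tmul (a : A) (b : B) (c : C) :
    preAssoc (tmul a b ⊗ₜ[ℂ] c) = tmul a (tmul b c) := by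
  change map (StarAlgHom.id ℂ A) (inl B C) (tmul a b) * tmul 1 (tmul 1 c) = _
  simp [inl_apply, tmul_mul_tmul]

section HilbertAssoc

variable {H K L M : Type u} [NormedAddCommGroup H] [InnerProductSpace ℂ H]
  [NormedAddCommGroup K] [InnerProductSpace ℂ K] [NormedAddCommGroup L] [InnerProductSpace ℂ L]
  [NormedAddCommGroup M] [InnerProductSpace ℂ M]

theorem denseRange_mapIsometry (f : H →ₗᵢ[ℂ] K) (g : L →ₗᵢ[ℂ] M) (hf : DenseRange f)
    (hg : DenseRange g) : DenseRange (TensorProduct.mapIsometry f g) := by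
  intro z
  induction z using TensorProduct.induction_on with
  | zero => exact subset_closure ⟨0, map_zero _⟩
  | tmul x y =>
    have h : Dense (Set.range f ×ˢ Set.range g) := Dense.prod hf hg
    refine map_mem_closure (f := fun p : K × M => p.1 ⊗ₜ[ℂ] p.2) TensorProduct.continuous_tmul
      (h (x, y)) ?_
    rintro ⟨_, _⟩ ⟨⟨a, rfl⟩, ⟨b, rfl⟩⟩
    exact ⟨a ⊗ₜ b, rfl⟩
  | add x y hx hy =>
    exact map_mem_closure₂ continuous_add hx hy (by
      rintro _ ⟨a, rfl⟩ _ ⟨b, rfl⟩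
      exact ⟨a + b, map_add _ _ _⟩)

theorem op_ext₃ {E : Type*} [NormedAddCommGroup E] [NormedSpace ℂ E]
    {S T : HilbertTensor (HilbertTensor H K) L →L[ℂ] E}
    (h : ∀ x y z, S (inc (inc (x ⊗ₜ[ℂ] y) ⊗ₜ[ℂ] z)) = T (inc (inc (x ⊗ₜ[ℂ] y) ⊗ₜ[ℂ] z))) :
    S = T := by
  refine op_ext fun w z => ?_
  have hc : Continuous fun w : HilbertTensor H K => (inc (w ⊗ₜ[ℂ] z) : HilbertTensor _ L) :=
    inc.continuous.comp (TensorProduct.continuous_tmul.comp (continuous_id.prodMk continuous_const))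
  induction w using denseRange_inc.induction_on with
  | hp => exact isClosed_eq (S.continuous.comp hc) (T.continuous.comp hc)
  | ih w =>
    induction w using TensorProduct.induction_on with
    | zero => simp
    | tmul x y => exact h x y z
    | add x y hx hy => simp only [map_add, TensorProduct.add_tmul, hx, hy]

theorem exists_hilbertAssoc : ∃ U : HilbertTensor (HilbertTensor H K) L →ₗᵢ[ℂ]
    HilbertTensor H (HilbertTensor K L), DenseRange U ∧
      ∀ x y z, U (inc (inc (x ⊗ₜ[ℂ] y) ⊗ₜ[ℂ] z)) = inc (x ⊗ₜ[ℂ] inc (y ⊗ₜ[ℂ] z)) := by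
  let V₁ := TensorProduct.mapIsometry (inc (H := H) (K := K)) (LinearIsometry.id (E := L) (R := ℂ))
  let V₂ := TensorProduct.mapIsometry (LinearIsometry.id (E := H) (R := ℂ)) (inc (H := K) (K := L))
  have h₁ : DenseRange V₁ := denseRange_mapIsometry _ _ denseRange_inc Function.surjective_id.denseRange
  have h₂ : DenseRange V₂ := denseRange_mapIsometry _ _ Function.surjective_id.denseRange denseRange_inc
  obtain ⟨U, hU, hU'⟩ := exists_extension (inc.comp V₁) (denseRange_inc.comp h₁ inc.continuous)
    ((inc.comp V₂).comp (TensorProduct.assocIsometry ℂ H K L).toLinearIsometry)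
    ((denseRange_inc.comp h₂ inc.continuous).comp
      (TensorProduct.assocIsometry ℂ H K L).surjective.denseRange (inc.comp V₂).continuous)
  exact ⟨U, hU, fun x y z => hU' ((x ⊗ₜ y) ⊗ₜ z)⟩

end HilbertAssoc

theorem preAssoc_intertwine (π : HilbertRep A) (σ : HilbertRep B) (τ : HilbertRep C)
    (U : HilbertTensor (HilbertTensor π.space σ.space) τ.space →ₗᵢ[ℂ]
      HilbertTensor π.space (HilbertTensor σ.space τ.space))
    (hU : ∀ x y z, U (inc (inc (x ⊗ₜ[ℂ] y) ⊗ₜ[ℂ] z)) = inc (x ⊗ₜ[ℂ] inc (y ⊗ₜ[ℂ] z)))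
    (a : A) (b : B) (c : C) :
    (tensorHom π (tensorRep σ τ) (preAssoc (tmul a b ⊗ₜ c))).comp U.toContinuousLinearMap
      = U.toContinuousLinearMap.comp (tensorAction (tensorRep π σ) τ (tmul a b ⊗ₜ c)) := by
  refine op_ext₃ fun x y z => ?_
  rw [preAssoc_tmul]
  change tensorHom π (tensorRep σ τ) (tmul a (tmul b c)) (U (inc (inc (x ⊗ₜ[ℂ] y) ⊗ₜ[ℂ] z)))
    = U (tensorAction (tensorRep π σ) τ (tmul a b ⊗ₜ c) (inc (inc (x ⊗ₜ[ℂ] y) ⊗ₜ[ℂ] z)))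
  rw [hU, tensorHom_tmul, tensorHom_tmul, tensorAction_tmul_tmul, tensorHom_tmul, hU]

theorem norm_preAssoc_le (x : SpatialTensor A B ⊗[ℂ] C) : ‖preAssoc x‖ ≤ spatialNorm x := by
  refine norm_le_of_forall₃ fun π σ τ => ?_
  obtain ⟨U, hU, hU'⟩ := exists_hilbertAssoc (H := π.space) (K := σ.space) (L := τ.space)
  refine (norm_le_of_intertwine U hU (T := tensorAction (tensorRep π σ) τ x) ?_).trans
    (le_spatialNorm (tensorRep π σ) τ x)
  suffices h : (tensorHom π (tensorRep σ τ) (preAssoc x)).comp U.toContinuousLinearMap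
      = U.toContinuousLinearMap.comp (tensorAction (tensorRep π σ) τ x) from
    fun z => DFunLike.congr_fun h z
  induction x using TensorProduct.induction_on with
  | zero => simp only [map_zero, ContinuousLinearMap.zero_comp, ContinuousLinearMap.comp_zero]
  | tmul w c =>
    induction w using induction_on with
    | hp =>
      have h₁ : Continuous fun w : SpatialTensor A B => preAssoc (w ⊗ₜ[ℂ] c) :=
        (continuous_hom (map (StarAlgHom.id ℂ A) (inl B C))).mul
          (continuous_const (y := inr A (SpatialTensor B C) (inr B C c)))
      have h₂ : Continuous fun w : SpatialTensor A B =>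
          tensorAction (tensorRep π σ) τ (w ⊗ₜ[ℂ] c) :=
        (continuous_hom ((ampLeft _ τ.space).comp (tensorHom π σ))).mul
          (continuous_const (y := ampRight (HilbertTensor π.space σ.space) _ (τ.hom c)))
      exact isClosed_eq
        (((continuous_hom (tensorHom π (tensorRep σ τ))).comp h₁).clm_comp continuous_const)
        (continuous_const.clm_comp h₂)
    | h a b => exact preAssoc_intertwine π σ τ U hU' a b c
    | add x y hx hy =>
      rw [TensorProduct.add_tmul, map_add, map_add, map_add, ContinuousLinearMap.add_comp, hx, hy,
        ContinuousLinearMap.comp_add]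
  | add x y hx hy =>
    rw [map_add, map_add, map_add, ContinuousLinearMap.add_comp, hx, hy,
      ContinuousLinearMap.comp_add]

/-- The associator `(a ⊗ b) ⊗ c ↦ a ⊗ (b ⊗ c)` as a ⋆-homomorphism. -/
def assoc (A B C : Type u) [CStarAlgebra A] [CStarAlgebra B] [CStarAlgebra C] :
    SpatialTensor (SpatialTensor A B) C →⋆ₐ[ℂ] SpatialTensor A (SpatialTensor B C) :=
  extend preAssoc norm_preAssoc_le

@[simp] theorem assoc_tmul (a : A) (b : B) (c : C) :
    assoc A B C (tmul (tmul a b) c) = tmul a (tmul b c) :=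
  (extend_tmul preAssoc norm_preAssoc_le _ _).trans (preAssoc_tmul a b c)

theorem continuous_tmul_left (b : B) : Continuous fun a : A => tmul a b := by
  have : (fun a : A => tmul a b) = fun a => inl A B a * tmul 1 b := by
    ext a
    rw [inl_apply, tmul_mul_tmul, mul_one, one_mul]
  rw [this]
  exact (continuous_hom (inl A B)).mul continuous_const

theorem continuous_tmul_right (a : A) : Continuous fun b : B => tmul a b := by
  have : (fun b : B => tmul a b) = fun b => tmul a 1 * inr A B b := by
    ext b
    rw [inr_apply, tmul_mul_tmul, mul_one, one_mul]
  rw [this]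
  exact continuous_const.mul (continuous_hom (inr A B))

theorem add_tmul (a a' : A) (b : B) : tmul (a + a') b = tmul a b + tmul a' b := by
  rw [tmul, TensorProduct.add_tmul, map_add]; rfl

theorem tmul_add (a : A) (b b' : B) : tmul a (b + b') = tmul a b + tmul a b' := by
  rw [tmul, TensorProduct.tmul_add, map_add]; rfl

theorem hom_ext_left {E : Type*} [CStarAlgebra E]
    {f g : SpatialTensor (SpatialTensor A B) C →⋆ₐ[ℂ] E}
    (h : ∀ a b c, f (tmul (tmul a b) c) = g (tmul (tmul a b) c)) : f = g :=
  hom_ext fun w c => by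
    induction w using induction_on with
    | hp =>
      exact isClosed_eq ((continuous_hom f).comp (continuous_tmul_left c))
        ((continuous_hom g).comp (continuous_tmul_left c))
    | h a b => exact h a b c
    | add x y hx hy => rw [add_tmul, map_add, map_add, hx, hy]

theorem hom_ext_right {E : Type*} [CStarAlgebra E]
    {f g : SpatialTensor A (SpatialTensor B C) →⋆ₐ[ℂ] E}
    (h : ∀ a b c, f (tmul a (tmul b c)) = g (tmul a (tmul b c))) : f = g :=
  hom_ext fun a w => by
    induction w using induction_on with
    | hp =>
      exact isClosed_eq ((continuous_hom f).comp (continuous_tmul_right a))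
        ((continuous_hom g).comp (continuous_tmul_right a))
    | h b c => exact h a b c
    | add x y hx hy => rw [tmul_add, map_add, map_add, hx, hy]

/-- The inverse associator `a ⊗ (b ⊗ c) ↦ (a ⊗ b) ⊗ c`, obtained from the associator by flips. -/
def assocInv (A B C : Type u) [CStarAlgebra A] [CStarAlgebra B] [CStarAlgebra C] :
    SpatialTensor A (SpatialTensor B C) →⋆ₐ[ℂ] SpatialTensor (SpatialTensor A B) C :=
  (map (comm B A) (StarAlgHom.id ℂ C)).comp <| (comm C (SpatialTensor B A)).comp <|
    (assoc C B A).comp <| (map (comm B C) (StarAlgHom.id ℂ A)).comp <|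
      comm A (SpatialTensor B C)

@[simp] theorem assocInv_tmul (a : A) (b : B) (c : C) :
    assocInv A B C (tmul a (tmul b c)) = tmul (tmul a b) c := by
  simp [assocInv]

theorem assocInv_comp_assoc (A B C : Type u) [CStarAlgebra A] [CStarAlgebra B] [CStarAlgebra C] :
    (assocInv A B C).comp (assoc A B C) = StarAlgHom.id ℂ _ :=
  hom_ext_left fun a b c => by simp

theorem assoc_comp_assocInv (A B C : Type u) [CStarAlgebra A] [CStarAlgebra B] [CStarAlgebra C] :
    (assoc A B C).comp (assocInv A B C) = StarAlgHom.id ℂ _ :=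
  hom_ext_right fun a b c => by simp

section Mul

open WeakDual

variable (B : Type u) [CommCStarAlgebra B]

/-- The one-dimensional representation given by a character. -/
def charRep (χ : characterSpace ℂ B) : HilbertRep B where
  space := EuclideanSpace ℂ PUnit.{u + 1}
  hom := (StarAlgHom.ofId ℂ _).comp (StarAlgHomClass.toStarAlgHom χ)

/-- The multiplication on the algebraic tensor product. -/
def preMul : B ⊗[ℂ] B →⋆ₐ[ℂ] B := algLift (StarAlgHom.id ℂ B) (StarAlgHom.id ℂ B) mul_comm

theorem norm_preMul_le (x : B ⊗[ℂ] B) : ‖preMul B x‖ ≤ spatialNorm x := by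
  have h : ‖preMul B x‖ = ‖gelfandTransform ℂ B (preMul B x)‖ :=
    ((AddMonoidHomClass.isometry_iff_norm _).1 (gelfandTransform_isometry B) _).symm
  rw [h, ContinuousMap.norm_le _ (spatialNorm_nonneg x)]
  intro χ
  change ‖χ (preMul B x)‖ ≤ _
  clear h
  have hx : tensorAction (charRep B χ) (charRep B χ) x
      = algebraMap ℂ _ (χ (preMul B x)) := by
    induction x using TensorProduct.induction_on with
    | zero => simp only [map_zero]
    | tmul b b' =>
      have h₁ : (charRep B χ).hom b = algebraMap ℂ _ (χ b) := rfl
      have h₂ : (charRep B χ).hom b' = algebraMap ℂ _ (χ b') := rfl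
      have h₃ : preMul B (b ⊗ₜ b') = b * b' := rfl
      rw [tensorAction_tmul, h₁, h₂, h₃, AlgHomClass.commutes, AlgHomClass.commutes, map_mul,
        map_mul]
    | add x y hx hy => simp only [map_add, hx, hy]
  refine le_trans ?_ (le_spatialNorm (charRep B χ) (charRep B χ) x)
  let e : (charRep B χ).space := (EuclideanSpace.single PUnit.unit 1 : EuclideanSpace ℂ PUnit)
  have he : ‖e‖ = 1 := by
    change ‖(EuclideanSpace.single PUnit.unit 1 : EuclideanSpace ℂ PUnit)‖ = 1
    simp
  have hv : ‖(inc (e ⊗ₜ[ℂ] e) : HilbertTensor (charRep B χ).space (charRep B χ).space)‖ = 1 := by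
    rw [inc.norm_map, TensorProduct.norm_tmul, he, one_mul]
  have := (tensorAction (charRep B χ) (charRep B χ) x).le_opNorm (inc (e ⊗ₜ[ℂ] e))
  rw [hv, mul_one] at this
  refine le_trans (le_of_eq ?_) this
  rw [hx, Algebra.algebraMap_eq_smul_one, smul_apply, one_apply_eq_self, norm_smul, hv, mul_one]

/-- The multiplication `b ⊗ b' ↦ b * b'` of a commutative C⋆-algebra. -/
def mul : SpatialTensor B B →⋆ₐ[ℂ] B := extend (preMul B) (norm_preMul_le B)

variable {B} in
@[simp] theorem mul_tmul (b b' : B) : mul B (tmul b b') = b * b' := extend_tmul _ _ _ _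

end Mul

/-- The map `I ⊗ F ⊗ I`, that is `(b ⊗ c) ⊗ (b' ⊗ c') ↦ (b ⊗ b') ⊗ (c ⊗ c')`, where `F` is the
flip `c ⊗ b' ↦ b' ⊗ c`. -/
def middleFlip (B C : Type u) [CStarAlgebra B] [CStarAlgebra C] :
    SpatialTensor (SpatialTensor B C) (SpatialTensor B C) →⋆ₐ[ℂ]
      SpatialTensor (SpatialTensor B B) (SpatialTensor C C) :=
  (assocInv B B (SpatialTensor C C)).comp <|
    (map (StarAlgHom.id ℂ B) <|
      (assoc B C C).comp <| (map (comm C B) (StarAlgHom.id ℂ C)).comp <| assocInv C B C).comp <|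
    assoc B C (SpatialTensor B C)

theorem middleFlip_tmul (b b' : B) (c c' : C) :
    middleFlip B C (tmul (tmul b c) (tmul b' c')) = tmul (tmul b b') (tmul c c') := by
  simp [middleFlip]

end SpatialTensor

open SpatialTensor

/-- A unital C⋆-algebra is finitely generated if some finite subset generates a dense unital
⋆-subalgebra. -/
def IsFinitelyGeneratedCStar (A : Type u) [CStarAlgebra A] : Prop :=
  ∃ S : Finset A, (StarAlgebra.adjoin ℂ (S : Set A)).topologicalClosure = ⊤

/-- A pair `(A, Δ)` of a unital C⋆-algebra and a unital ⋆-homomorphism `Δ : A → A ⊗ A` is a compact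
quantum semigroup if `Δ` is coassociative: `(Δ ⊗ I) Δ = (I ⊗ Δ) Δ`, up to the canonical
identification `(A ⊗ A) ⊗ A ≅ A ⊗ (A ⊗ A)`. -/
def IsCompactQuantumSemigroup {A : Type u} [CStarAlgebra A]
    (Δ : A →⋆ₐ[ℂ] SpatialTensor A A) : Prop :=
  (assoc A A A).comp ((map Δ (StarAlgHom.id ℂ A)).comp Δ)
    = (map (StarAlgHom.id ℂ A) Δ).comp Δ

/-- `(C, Φ)`, with `Φ : A → B ⊗ C`, is the quantum family of all maps from the quantum space of `B`
to the quantum space of `A`: every `Ψ : A → B ⊗ D` factors as `(I_B ⊗ Γ) Φ` for a unique unital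
⋆-homomorphism `Γ : C → D`. -/
def IsQuantumFamilyOfAllMaps {A B C : Type u} [CStarAlgebra A] [CStarAlgebra B] [CStarAlgebra C]
    (Φ : A →⋆ₐ[ℂ] SpatialTensor B C) : Prop :=
  ∀ (D : Type u) [CStarAlgebra D] (Ψ : A →⋆ₐ[ℂ] SpatialTensor B D),
    ∃! Γ : C →⋆ₐ[ℂ] D, (map (StarAlgHom.id ℂ B) Γ).comp Φ = Ψ

/-- `Γ : C → C ⊗ C` makes the defining diagram of the induced comultiplication commute:
`(I_B ⊗ Γ) Φ = (m ⊗ I_{C ⊗ C}) (I_B ⊗ F ⊗ I_C) (Φ ⊗ Φ) Δ`. -/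
def IsInducedComultiplication {A B C : Type u} [CStarAlgebra A] [CommCStarAlgebra B]
    [CStarAlgebra C] (Δ : A →⋆ₐ[ℂ] SpatialTensor A A) (Φ : A →⋆ₐ[ℂ] SpatialTensor B C)
    (Γ : C →⋆ₐ[ℂ] SpatialTensor C C) : Prop :=
  (map (StarAlgHom.id ℂ B) Γ).comp Φ
    = (map (mul B) (StarAlgHom.id ℂ (SpatialTensor C C))).comp
        ((middleFlip B C).comp ((map Φ Φ).comp Δ))

end

end

/-!
Every `α : A → B ⊗ D` and `β : A → B ⊗ E` have a convolution product `α * β : A → B ⊗ (D ⊗ E)`: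
apply `Δ`, then `α ⊗ β`, then multiply the two legs in `B`. The product of maps from the quantum
space of `B` to the quantum semigroup of `A` is dual to this operation, and the defining equation of
`Γ` reads `(I ⊗ Γ) Φ = Φ * Φ`. The universal property of `(C, Φ)`, applied to `Φ * Φ`, therefore
gives existence and uniqueness of `Γ`.

For coassociativity, the convolution product is natural in `D` and `E` (`convolution_map`) and, as
`Δ` is coassociative and `B` is associative, it is associative up to the associator
(`convolution_assoc`). Hence `(I ⊗ (Γ ⊗ I) Γ) Φ = (Φ * Φ) * Φ` and
`(I ⊗ (I ⊗ Γ) Γ) Φ = Φ * (Φ * Φ)` correspond under the associator, and the uniqueness part of the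
universal property, this time with target `C ⊗ (C ⊗ C)`, gives the claim.
-/

noncomputable section

namespace SpatialTensor

/-! ### Functoriality of the spatial tensor product -/

section Functoriality

variable {A A' A'' B B' B'' C C' : Type u} [CStarAlgebra A] [CStarAlgebra A'] [CStarAlgebra A'']
  [CStarAlgebra B] [CStarAlgebra B'] [CStarAlgebra B''] [CStarAlgebra C] [CStarAlgebra C']

theorem one_eq_tmul : (1 : SpatialTensor A B) = tmul 1 1 := rfl

/-- A ⋆-homomorphism on `A ⊗ B` is determined by its restrictions to the two legs. Unlike
`hom_ext`, this can be iterated when `A` and `B` are themselves tensor products. -/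
theorem hom_ext_legs {E : Type*} [CStarAlgebra E] {f g : SpatialTensor A B →⋆ₐ[ℂ] E}
    (hl : f.comp (inl A B) = g.comp (inl A B)) (hr : f.comp (inr A B) = g.comp (inr A B)) :
    f = g := by
  refine hom_ext fun a b => ?_
  have h : tmul a b = inl A B a * inr A B b := by
    rw [inl_apply, inr_apply, tmul_mul_tmul, mul_one, one_mul]
  rw [h, map_mul, map_mul]
  exact congrArg₂ (· * ·) (DFunLike.congr_fun hl a) (DFunLike.congr_fun hr b)

theorem map_comp_map (f' : A' →⋆ₐ[ℂ] A'') (f : A →⋆ₐ[ℂ] A') (g' : B' →⋆ₐ[ℂ] B'')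
    (g : B →⋆ₐ[ℂ] B') : (map f' g').comp (map f g) = map (f'.comp f) (g'.comp g) :=
  hom_ext fun a b => by simp

theorem assoc_comp_map (f : A →⋆ₐ[ℂ] A') (g : B →⋆ₐ[ℂ] B') (h : C →⋆ₐ[ℂ] C') :
    (assoc A' B' C').comp (map (map f g) h) = (map f (map g h)).comp (assoc A B C) :=
  hom_ext_left fun a b c => by simp

end Functoriality

/-! ### Multiplication of the first legs -/

section LegMul

variable {B C D D' E E' : Type u} [CommCStarAlgebra B] [CStarAlgebra C] [CStarAlgebra D]
  [CStarAlgebra D'] [CStarAlgebra E] [CStarAlgebra E']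

variable (B D E) in
/-- The ⋆-homomorphism `(b ⊗ d) ⊗ (b' ⊗ e) ↦ b b' ⊗ (d ⊗ e)`. For `D = E` it is `middleFlip`
followed by the multiplication of `B`; distinct `D` and `E` are needed for iterated products. -/
def legMul : SpatialTensor (SpatialTensor B D) (SpatialTensor B E) →⋆ₐ[ℂ]
    SpatialTensor B (SpatialTensor D E) :=
  (map (mul B) (StarAlgHom.id ℂ (SpatialTensor D E))).comp <|
    (assocInv B B (SpatialTensor D E)).comp <|
      (map (StarAlgHom.id ℂ B) <|
        (assoc B D E).comp <| (map (comm D B) (StarAlgHom.id ℂ E)).comp <| assocInv D B E).comp <|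
      assoc B D (SpatialTensor B E)

@[simp] theorem legMul_tmul (b b' : B) (d : D) (e : E) :
    legMul B D E (tmul (tmul b d) (tmul b' e)) = tmul (b * b') (tmul d e) := by
  simp [legMul]

theorem legMul_comp_map (f : D →⋆ₐ[ℂ] D') (g : E →⋆ₐ[ℂ] E') :
    (legMul B D' E').comp (map (map (StarAlgHom.id ℂ B) f) (map (StarAlgHom.id ℂ B) g))
      = (map (StarAlgHom.id ℂ B) (map f g)).comp (legMul B D E) := by
  refine hom_ext_legs (hom_ext fun b d => ?_) (hom_ext fun b e => ?_) <;>
    simp [inl_apply, inr_apply, one_eq_tmul, -map_one]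

/-- Multiplication of the first legs is associative, because the multiplication of `B` is. -/
theorem legMul_assoc :
    (map (StarAlgHom.id ℂ B) (assoc C D E)).comp
        ((legMul B (SpatialTensor C D) E).comp
          (map (legMul B C D) (StarAlgHom.id ℂ (SpatialTensor B E))))
      = (legMul B C (SpatialTensor D E)).comp
        ((map (StarAlgHom.id ℂ (SpatialTensor B C)) (legMul B D E)).comp
          (assoc (SpatialTensor B C) (SpatialTensor B D) (SpatialTensor B E))) := by
  refine hom_ext_legs (hom_ext_legs (hom_ext fun b c => ?_) (hom_ext fun b d => ?_))
    (hom_ext fun b e => ?_) <;>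
    simp [inl_apply, inr_apply, one_eq_tmul, -map_one]

end LegMul

/-! ### The convolution product -/

section Convolution

variable {A B C D D' E E' : Type u} [CStarAlgebra A] [CommCStarAlgebra B] [CStarAlgebra C]
  [CStarAlgebra D] [CStarAlgebra D'] [CStarAlgebra E] [CStarAlgebra E']

/-- The convolution product of `α : A → B ⊗ D` and `β : A → B ⊗ E` along `Δ : A → A ⊗ A`. It is
dual to the pointwise product of two quantum families of maps into the quantum semigroup of `A`. -/
def convolution (Δ : A →⋆ₐ[ℂ] SpatialTensor A A) (α : A →⋆ₐ[ℂ] SpatialTensor B D)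
    (β : A →⋆ₐ[ℂ] SpatialTensor B E) : A →⋆ₐ[ℂ] SpatialTensor B (SpatialTensor D E) :=
  (legMul B D E).comp ((map α β).comp Δ)

theorem convolution_map (Δ : A →⋆ₐ[ℂ] SpatialTensor A A) (α : A →⋆ₐ[ℂ] SpatialTensor B D)
    (β : A →⋆ₐ[ℂ] SpatialTensor B E) (f : D →⋆ₐ[ℂ] D') (g : E →⋆ₐ[ℂ] E') :
    (map (StarAlgHom.id ℂ B) (map f g)).comp (convolution Δ α β)
      = convolution Δ ((map (StarAlgHom.id ℂ B) f).comp α)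
          ((map (StarAlgHom.id ℂ B) g).comp β) := by
  rw [convolution, convolution, ← map_comp_map, ← StarAlgHom.comp_assoc, ← legMul_comp_map]
  rfl

theorem convolution_assoc {Δ : A →⋆ₐ[ℂ] SpatialTensor A A} (hΔ : IsCompactQuantumSemigroup Δ)
    (α : A →⋆ₐ[ℂ] SpatialTensor B C) (β : A →⋆ₐ[ℂ] SpatialTensor B D)
    (γ : A →⋆ₐ[ℂ] SpatialTensor B E) :
    (map (StarAlgHom.id ℂ B) (assoc C D E)).comp (convolution Δ (convolution Δ α β) γ)
      = convolution Δ α (convolution Δ β γ) := by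
  have hl : map (convolution Δ α β) γ
      = (map (legMul B C D) (StarAlgHom.id ℂ _)).comp
          ((map (map α β) γ).comp (map Δ (StarAlgHom.id ℂ A))) := by
    rw [map_comp_map, map_comp_map]; rfl
  have hr : map α (convolution Δ β γ)
      = (map (StarAlgHom.id ℂ _) (legMul B D E)).comp
          ((map α (map β γ)).comp (map (StarAlgHom.id ℂ A) Δ)) := by
    rw [map_comp_map, map_comp_map]; rfl
  calc (map (StarAlgHom.id ℂ B) (assoc C D E)).comp (convolution Δ (convolution Δ α β) γ)
      = ((map (StarAlgHom.id ℂ B) (assoc C D E)).comp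
          ((legMul B (SpatialTensor C D) E).comp (map (legMul B C D) (StarAlgHom.id ℂ _)))).comp
            ((map (map α β) γ).comp ((map Δ (StarAlgHom.id ℂ A)).comp Δ)) := by
        rw [convolution, hl]; rfl
    _ = ((legMul B C (SpatialTensor D E)).comp
          (map (StarAlgHom.id ℂ _) (legMul B D E))).comp
            (((assoc _ _ _).comp (map (map α β) γ)).comp
              ((map Δ (StarAlgHom.id ℂ A)).comp Δ)) := by
        rw [legMul_assoc]; rfl
    _ = ((legMul B C (SpatialTensor D E)).comp
          (map (StarAlgHom.id ℂ _) (legMul B D E))).comp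
            ((map α (map β γ)).comp
              ((assoc A A A).comp ((map Δ (StarAlgHom.id ℂ A)).comp Δ))) := by
        rw [assoc_comp_map]; rfl
    _ = convolution Δ α (convolution Δ β γ) := by
        rw [hΔ, convolution, hr]; rfl

/-- Holds by definition: `legMul B C C` unfolds to `middleFlip B C` followed by `m ⊗ I`. -/
theorem isInducedComultiplication_iff {Δ : A →⋆ₐ[ℂ] SpatialTensor A A}
    {Φ : A →⋆ₐ[ℂ] SpatialTensor B C} {Γ : C →⋆ₐ[ℂ] SpatialTensor C C} :
    IsInducedComultiplication Δ Φ Γ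
      ↔ (map (StarAlgHom.id ℂ B) Γ).comp Φ = convolution Δ Φ Φ :=
  Iff.rfl

/-- Both sides of the coassociativity equation of `Γ`, after `Φ`, are triple convolution products
of `Φ`, and `Φ` separates ⋆-homomorphisms out of `C`. -/
theorem isCompactQuantumSemigroup_of_isInducedComultiplication {Δ : A →⋆ₐ[ℂ] SpatialTensor A A}
    {Φ : A →⋆ₐ[ℂ] SpatialTensor B C} {Γ : C →⋆ₐ[ℂ] SpatialTensor C C}
    (hΓ : IsInducedComultiplication Δ Φ Γ) (hΔ : IsCompactQuantumSemigroup Δ)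
    (hΦ : IsQuantumFamilyOfAllMaps Φ) : IsCompactQuantumSemigroup Γ := by
  rw [isInducedComultiplication_iff] at hΓ
  have hid : (map (StarAlgHom.id ℂ B) (StarAlgHom.id ℂ C)).comp Φ = Φ := by
    have : map (StarAlgHom.id ℂ B) (StarAlgHom.id ℂ C) = StarAlgHom.id ℂ _ :=
      hom_ext fun b c => by simp
    rw [this, StarAlgHom.id_comp]
  have hsplit : ∀ {X Y : Type u} [CStarAlgebra X] [CStarAlgebra Y] (f : X →⋆ₐ[ℂ] Y)
      (g : C →⋆ₐ[ℂ] X), (map (StarAlgHom.id ℂ B) (f.comp g)).comp Φ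
        = (map (StarAlgHom.id ℂ B) f).comp ((map (StarAlgHom.id ℂ B) g).comp Φ) := by
    intro X Y _ _ f g
    rw [← StarAlgHom.comp_assoc, map_comp_map, StarAlgHom.id_comp]
  refine (hΦ _ (convolution Δ Φ (convolution Δ Φ Φ))).unique ?_ ?_
  · rw [hsplit, hsplit, hΓ, convolution_map, hid, hΓ, convolution_assoc hΔ]
  · rw [hsplit, hΓ, convolution_map, hid, hΓ]

end Convolution

end SpatialTensor

end

theorem theorem1 {A B C : Type u} [CStarAlgebra A] [CommCStarAlgebra B] [CStarAlgebra C]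
    [FiniteDimensional ℂ B]
    (Δ : A →⋆ₐ[ℂ] SpatialTensor A A) (hΔ : IsCompactQuantumSemigroup Δ)
    (hA : IsFinitelyGeneratedCStar A)
    (Φ : A →⋆ₐ[ℂ] SpatialTensor B C) (hΦ : IsQuantumFamilyOfAllMaps Φ) :
    ∃ Γ : C →⋆ₐ[ℂ] SpatialTensor C C,
      IsInducedComultiplication Δ Φ Γ ∧
      (∀ Γ' : C →⋆ₐ[ℂ] SpatialTensor C C, IsInducedComultiplication Δ Φ Γ' → Γ' = Γ) ∧
      IsCompactQuantumSemigroup Γ := by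
  obtain ⟨Γ, hΓ, huniq⟩ := hΦ (SpatialTensor C C) (SpatialTensor.convolution Δ Φ Φ)
  exact ⟨Γ, hΓ, huniq,
    SpatialTensor.isCompactQuantumSemigroup_of_isInducedComultiplication hΓ hΔ hΦ⟩
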